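/- Let $V$ be a finite set with $d=|V|\ge 2$ elements, let $\mathcal I_v$ ($v\in V$) be finite sets, and let $\mathcal I=\prod_{v\in V}\mathcal I_v$. Let $\mathbf p=(\mathbf p(\underline i))_{\underline i\in\mathcal I}$ be a vector of random cell probabilities, i.e. a random vector with $\mathbf p(\underline i)>0$ for all $\underline i$ and $\sum_{\underline i\in\mathcal I}\mathbf p(\underline i)=1$ almost surely. For $D\subset V$, $v\in V$, $m\in\mathcal I_v$ and $\underline k\in\mathcal I_D=\prod_{u\in D}\mathcal I_u$ put $$\mathbb P_{\mathbf p}(X_v=m\mid X_D=\underline k)=\frac{\sum_{\underline i:\ \underline i_D=\underline k,\ i_v=m}\mathbf p(\underline i)}{\sum_{\underline i:\ \underline i_D=\underline k}\mathbf p(\underline i)} .$$ A directed acyclic graph (DAG) on $V$ is described by its parent function $\mathfrak p$, where $\mathfrak p_v\subset V$ is the set of parents of $v$. A DAG whose skeleton is the complete graph on $V$ has a unique numbering $v_1,\dots,v_d$ of $V$ with $\mathfrak p_{v_1}=\emptyset$ and $\mathfrak p_{v_j}=\mathfrak p_{v_{j-1}}\cup\{v_{j-1}\}$ for $j=2,\dots,d$.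 Parameter independence for $\mathbf p$ with respect to $\mathfrak p$ means that the random vectors $$\bigl(\mathbb P_{\mathbf p}(X_v=m\mid X_{\mathfrak p_v}=\underline k)\bigr)_{m\in\mathcal I_v},\qquad \underline k\in\mathcal I_{\mathfrak p_v},\ v\in V,$$ are mutually independent and that each of them is non-degenerate (not almost surely constant). Let $\mathfrak p$ and $\mathfrak p'$ be the parent functions of two DAGs whose skeleton is the complete graph on $V$, with the corresponding numberings $v_1,\dots,v_d$ and $v'_1,\dots,v'_d$, and suppose that $$\mathfrak p_{v_j}\neq\mathfrak p'_{v'_j}\qquad\text{for all } j=2,\dots,d .$$ If parameter independence holds for $\mathbf p$ with respect to $\mathfrak p$ and with respect to $\mathfrak p'$, then $\mathbf p$ has a classical Dirichlet distribution: there are $\alpha_{\underline i}>0$ ($\underline i\in\mathcal I$) such that, for any choice of a cell $\underline i_0$, the coordinates $(\mathbf p(\underline i))_{\underline i\ne\underline i_0}$ have the density $$\frac{\Gamma\bigl(\sum_{\underline i\in\mathcal I}\alpha_{\underline i}\bigr)}{\prod_{\underline i\in\mathcal I}\Gamma(\alpha_{\underline i})}\prod_{\underline i\in\mathcal I}x_{\underline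 i}^{\alpha_{\underline i}-1},\qquad x_{\underline i_0}=1-\sum_{\underline i\ne\underline i_0}x_{\underline i},$$ with respect to Lebesgue measure on $\{x\in(0,1)^{\mathcal I\setminus\{\underline i_0\}}:\ \sum_{\underline i\neq\underline i_0}x_{\underline i}<1\}$, and $\mathbf p(\underline i_0)=1-\sum_{\underline i\ne\underline i_0}\mathbf p(\underline i)$ almost surely. No density of $\mathbf p$ is assumed. -/

import Mathlib

open MeasureTheory ProbabilityTheory

/-! ### DAGs given by their parent functions -/

section DAG

variable {V : Type*}

/-- The undirected skeleton of the directed graph with parent function `𝔭`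
(there is an arrow `u → v` iff `u ∈ 𝔭 v`). -/
def dagSkeleton (𝔭 : V → Finset V) : SimpleGraph V :=
  SimpleGraph.fromRel (fun u v => u ∈ 𝔭 v)

/-- `𝔭` is the parent function of a directed acyclic graph. -/
def IsAcyclicParentFunction (𝔭 : V → Finset V) : Prop :=
  ∀ v, ¬ Relation.TransGen (fun u w => u ∈ 𝔭 w) v v

/-- `𝔭` is moral: distinct parents of a common child are joined by an edge of the skeleton. -/
def IsMoralParentFunction (𝔭 : V → Finset V) : Prop :=
  ∀ w u u', u ∈ 𝔭 w → u' ∈ 𝔭 w → u ≠ u' → (dagSkeleton 𝔭).Adj u u'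

/-- `𝔭` is the parent function of a moral DAG with skeleton `G`. -/
structure IsMoralDAG (G : SimpleGraph V) (𝔭 : V → Finset V) : Prop where
  acyclic : IsAcyclicParentFunction 𝔭
  skeleton : dagSkeleton 𝔭 = G
  moral : IsMoralParentFunction 𝔭

/-- `v₁, …, v_d` (here `v 0, …, v (d - 1)`) is the numbering of the vertices of a DAG on the
complete graph: `𝔭_{v₁} = ∅` and `𝔭_{v_j} = 𝔭_{v_{j-1}} ∪ {v_{j-1}}` for `j ≥ 2`. -/
structure IsVertexNumbering [DecidableEq V] {d : ℕ} (𝔭 : V → Finset V) (v : Fin d ≃ V) :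
    Prop where
  first : ∀ j : Fin d, j.val = 0 → 𝔭 (v j) = ∅
  next : ∀ j k : Fin d, k.val = j.val + 1 → 𝔭 (v k) = insert (v j) (𝔭 (v j))

end DAG

/-! ### Cell probabilities and parameter independence -/

section Cells

variable {V : Type*} {I : V → Type*} [Fintype V] [DecidableEq V]
  [∀ v, Fintype (I v)] [∀ v, DecidableEq (I v)]

/-- `ℙ_p(X_D = k)`, the probability of the `D`-marginal cell `k` under the cell
probabilities `p`. -/
def marginalProb (p : (∀ v, I v) → ℝ) (D : Finset V) (k : ∀ u : D, I u) : ℝ :=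
  ∑ i with D.restrict i = k, p i

/-- `ℙ_p(X_v = m | X_D = k) = ℙ_p(X_D = k, X_v = m) / ℙ_p(X_D = k)`. -/
noncomputable def condCellProb (p : (∀ v, I v) → ℝ) (v : V) (D : Finset V)
    (k : ∀ u : D, I u) (m : I v) : ℝ :=
  (∑ i with D.restrict i = k ∧ i v = m, p i) / marginalProb p D k

variable {Ω : Type*} [MeasurableSpace Ω]

/-- A vector of random cell probabilities: a random vector indexed by the cells whose
coordinates are (almost surely) positive and sum to one. -/
structure IsRandomCellProb (P : Measure Ω) (p : Ω → (∀ v, I v) → ℝ) : Prop where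
  measurable : Measurable p
  pos : ∀ᵐ ω ∂P, ∀ i, 0 < p ω i
  sum_eq_one : ∀ᵐ ω ∂P, ∑ i, p ω i = 1

/-- The random vector `(ℙ_𝐩(X_v = m | X_{𝔭_v} = k), m ∈ I_v)`, where `s = ⟨v, k⟩` runs over
the vertices `v` together with a configuration `k` of the parents of `v`. -/
noncomputable def dagParameter (p : Ω → (∀ v, I v) → ℝ) (𝔭 : V → Finset V)
    (s : (v : V) × (∀ u : 𝔭 v, I u)) (ω : Ω) : I s.1 → ℝ :=
  fun m => condCellProb (p ω) s.1 (𝔭 s.1) s.2 m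

/-- Parameter independence (local and global) with respect to the DAG with parent function `𝔭`:
the random vectors `(ℙ_𝐩(X_v = m | X_{𝔭_v} = k), m ∈ I_v)`, over all `v` and all `k`,
are mutually independent, and none of them is almost surely constant. -/
structure ParameterIndependence (P : Measure Ω) (p : Ω → (∀ v, I v) → ℝ) (𝔭 : V → Finset V) :
    Prop where
  indep : iIndepFun (dagParameter p 𝔭) P
  nondegenerate : ∀ s : (v : V) × (∀ u : 𝔭 v, I u),
    ¬ ∃ c : I s.1 → ℝ, ∀ᵐ ω ∂P, dagParameter p 𝔭 s ω = c

end Cells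

/-! ### The classical Dirichlet distribution -/

section Dirichlet

variable {ι : Type*} [Fintype ι] [DecidableEq ι]

/-- Complete the free coordinates `x i`, `i ≠ i₀`, by `x i₀ = 1 - ∑ x i`. -/
def simplexCompletion (i₀ : ι) (x : {i : ι // i ≠ i₀} → ℝ) : ι → ℝ :=
  fun i => if h : i = i₀ then 1 - ∑ j, x j else x ⟨i, h⟩

theorem measurable_simplexCompletion (i₀ : ι) : Measurable (simplexCompletion i₀) := by
  refine measurable_pi_lambda _ fun i => ?_
  unfold simplexCompletion
  by_cases h : i = i₀ <;> simp only [h, dite_true, dite_false] <;> fun_prop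

/-- The open simplex of free coordinates. -/
def openSimplex (i₀ : ι) : Set ({i : ι // i ≠ i₀} → ℝ) :=
  {x | (∀ j, x j ∈ Set.Ioo (0 : ℝ) 1) ∧ ∑ j, x j < 1}

/-- The Dirichlet density with parameters `α`, in the free coordinates `x i`, `i ≠ i₀`. -/
noncomputable def dirichletDensity (α : ι → ℝ) (i₀ : ι) (x : {i : ι // i ≠ i₀} → ℝ) : ℝ :=
  (openSimplex i₀).indicator
    (fun x => Real.Gamma (∑ i, α i) / (∏ i, Real.Gamma (α i)) *
      ∏ i, simplexCompletion i₀ x i ^ (α i - 1)) x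

/-- The Dirichlet law on `ι → ℝ`: the free coordinates have the Dirichlet density with respect
to Lebesgue measure, and the coordinate `i₀` is one minus their sum. -/
noncomputable def dirichletMeasure (α : ι → ℝ) (i₀ : ι) : Measure (ι → ℝ) :=
  (volume.withDensity fun x => ENNReal.ofReal (dirichletDensity α i₀ x)).map
    (simplexCompletion i₀)

/-- `μ` is a classical Dirichlet distribution with positive parameters; the description by a
density holds whichever coordinate is eliminated. -/
def IsClassicalDirichlet (μ : Measure (ι → ℝ)) : Prop :=
  Nonempty ι ∧ ∃ α : ι → ℝ, (∀ i, 0 < α i) ∧ ∀ i₀, μ = dirichletMeasure α i₀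

end Dirichlet

/-! Regard the mixed moment `M n = E[∏_{i ∈ n} 𝐩 i]` as the probability of the sample `n`. The
product `∏_{i ∈ n} 𝐩 i` is a product over the vertices `v` and the configurations of the parents of
`v`, so parameter independence factors `M n` in the same way. The ratio by which one more
observation `i'` changes the predictive probability `M (n + i) / M n` of a cell `i` is then a
product as well. If `i` and `i'` differ at `w`, the factors of the vertices having `w` as a parent
are `1`, and the ratio depends only on what is seen of `i`, `i'` and `n` on `w` and its parents.

This holds for both orders. At the two first vertices, which are distinct, it leaves a ratio
depending on the size of `n` only. At the vertex `v_j` the condition `𝔭_{v_j} ≠ 𝔭'_{v'_j}` provides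
an earlier vertex of the other order that is not a parent of `v_j`; making the cells differ there
does not change the ratio, and induction on `j` reduces every pair of distinct cells to the first
vertices.

As the predictive probabilities sum to one and a sample may be extended in either order, the ratios
after successive sample sizes satisfy `ρ (N + 1) * (2 - ρ N) = 1`. Non-degeneracy gives `ρ 0 < 1`,
so `ρ N = (A + N) / (A + N + 1)`: the predictive probabilities are those of a Pólya urn, and `M` is
the moment sequence of a Dirichlet law. Laws on the simplex are determined by their moments.
-/

section Numbering

/-- The family of a vertex: the vertex together with its parents. -/
def dagFamily {V : Type*} [DecidableEq V] (𝔭 : V → Finset V) (w : V) : Finset V :=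
  insert w (𝔭 w)

theorem self_mem_dagFamily {V : Type*} [DecidableEq V] (𝔭 : V → Finset V) (w : V) :
    w ∈ dagFamily 𝔭 w :=
  Finset.mem_insert_self _ _

variable {V : Type*} [DecidableEq V] {d : ℕ} {𝔭 𝔭' : V → Finset V} {v v' : Fin d ≃ V}

namespace IsVertexNumbering

theorem mem_parents_iff (hv : IsVertexNumbering 𝔭 v) {s t : Fin d} :
    v s ∈ 𝔭 (v t) ↔ s < t := by
  obtain ⟨t, ht⟩ := t
  induction t with
  | zero => simp [hv.first ⟨0, ht⟩ rfl, Fin.lt_def]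
  | succ t ih =>
    rw [hv.next ⟨t, by omega⟩ ⟨t + 1, ht⟩ rfl, Finset.mem_insert, ih (by omega),
      v.injective.eq_iff, Fin.lt_def, Fin.lt_def, Fin.ext_iff]
    simp only
    omega

theorem parents_eq_map_Iio (hv : IsVertexNumbering 𝔭 v) (t : Fin d) :
    𝔭 (v t) = (Finset.Iio t).map v.toEmbedding := by
  ext x
  obtain ⟨s, rfl⟩ := v.surjective x
  simp [hv.mem_parents_iff]

theorem notMem_parents_self (hv : IsVertexNumbering 𝔭 v) (w : V) : w ∉ 𝔭 w := by
  obtain ⟨t, rfl⟩ := v.surjective w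
  simp [hv.mem_parents_iff]

theorem dagFamily_subset_or_mem_parents (hv : IsVertexNumbering 𝔭 v) (w w' : V) :
    dagFamily 𝔭 w' ⊆ dagFamily 𝔭 w ∨ w ∈ 𝔭 w' := by
  obtain ⟨s, rfl⟩ := v.surjective w
  obtain ⟨t, rfl⟩ := v.surjective w'
  rw [hv.mem_parents_iff]
  rcases lt_or_ge s t with hst | hts
  · exact Or.inr hst
  · refine Or.inl fun x hx => ?_
    obtain ⟨r, rfl⟩ := v.surjective x
    simp only [dagFamily, Finset.mem_insert, hv.mem_parents_iff, v.injective.eq_iff] at hx ⊢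
    omega

theorem exists_lt_notMem_parents (hv : IsVertexNumbering 𝔭 v) (hv' : IsVertexNumbering 𝔭' v')
    {t : Fin d} (hne : 𝔭 (v t) ≠ 𝔭' (v' t)) : ∃ s < t, v' s ∉ 𝔭 (v t) := by
  by_contra! hmem
  refine hne (Finset.eq_of_subset_of_card_le (fun x hx => ?_) ?_).symm
  · obtain ⟨s, rfl⟩ := v'.surjective x
    exact hmem s (hv'.mem_parents_iff.mp hx)
  · simp [hv.parents_eq_map_Iio, hv'.parents_eq_map_Iio]

theorem univ_induction [Fintype V] (hv : IsVertexNumbering 𝔭 v) {C : Finset V → Prop}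
    (empty : C ∅) (family : ∀ w, C (𝔭 w) → C (dagFamily 𝔭 w)) : C Finset.univ := by
  have parents : ∀ t : Fin d, C (𝔭 (v t)) := by
    rintro ⟨t, ht⟩
    induction t with
    | zero => exact hv.first ⟨0, ht⟩ rfl ▸ empty
    | succ t ih => exact hv.next ⟨t, by omega⟩ ⟨t + 1, ht⟩ rfl ▸ family _ (ih (by omega))
  cases d with
  | zero =>
    have : IsEmpty V := v.symm.isEmpty
    exact Finset.univ_eq_empty (α := V) ▸ empty
  | succ d =>
    have last : dagFamily 𝔭 (v (Fin.last d)) = Finset.univ := by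
      ext x
      obtain ⟨s, rfl⟩ := v.surjective x
      simpa [dagFamily, hv.mem_parents_iff] using (Fin.le_last s).eq_or_lt
    exact last ▸ family _ (parents _)

end IsVertexNumbering

end Numbering

section Predictive

variable {ι K : Type*}

/-- The predictive probability that the next observation is `i` after the sample `n`, when `M n`
is the probability of the sample `n`. Samples are multisets, as their order is irrelevant. -/
def predictive [Div K] (M : Multiset ι → K) (n : Multiset ι) (i : ι) : K :=
  M (i ::ₘ n) / M n

/-- The factor by which one more observation `j` changes the predictive probability of `i`. It is
the exponential of the second mixed difference of `log M` in the directions `i` and `j`. -/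
def predictiveRatio [Div K] (M : Multiset ι → K) (i j : ι) (n : Multiset ι) : K :=
  predictive M (j ::ₘ n) i / predictive M n i

theorem predictiveRatio_prod {σ : Type*} [DivisionCommMonoid K] [Fintype σ]
    (M : σ → Multiset ι → K) (i j : ι) (n : Multiset ι) :
    predictiveRatio (fun n => ∏ s, M s n) i j n = ∏ s, predictiveRatio (M s) i j n := by
  simp only [predictiveRatio, predictive, Finset.prod_div_distrib]

end Predictive

section FamilySample

variable {V : Type*} {I : V → Type*} [∀ v, DecidableEq (I v)]

/-- The values at the vertex `s.1` of the observations in the sample `n` whose parent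
configuration is `s.2`. -/
def familySample (𝔭 : V → Finset V) (s : (v : V) × (∀ u : 𝔭 v, I u))
    (n : Multiset (∀ v, I v)) : Multiset (I s.1) :=
  (n.filter fun i => (𝔭 s.1).restrict i = s.2).map fun i => i s.1

variable {𝔭 : V → Finset V} {s : (v : V) × (∀ u : 𝔭 v, I u)}

theorem familySample_cons_of_eq {i : ∀ v, I v} (hi : (𝔭 s.1).restrict i = s.2)
    (n : Multiset (∀ v, I v)) : familySample 𝔭 s (i ::ₘ n) = i s.1 ::ₘ familySample 𝔭 s n := by
  simp [familySample, hi]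

theorem familySample_cons_of_ne {i : ∀ v, I v} (hi : (𝔭 s.1).restrict i ≠ s.2)
    (n : Multiset (∀ v, I v)) : familySample 𝔭 s (i ::ₘ n) = familySample 𝔭 s n := by
  simp [familySample, hi]

theorem predictiveRatio_comp_familySample_eq_one {K : Type*} [CommGroupWithZero K]
    {g : Multiset (I s.1) → K} (hg : ∀ n, g (familySample 𝔭 s n) ≠ 0)
    {w : V} (hw : w ∈ 𝔭 s.1) {i i' : ∀ v, I v} (hi : i w ≠ i' w) (n : Multiset (∀ v, I v)) :
    predictiveRatio (fun n => g (familySample 𝔭 s n)) i i' n = 1 := by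
  have incompatible : (𝔭 s.1).restrict i ≠ s.2 ∨ (𝔭 s.1).restrict i' ≠ s.2 := by
    by_contra! h
    exact hi (congrFun (h.1.trans h.2.symm) ⟨w, hw⟩)
  unfold predictiveRatio predictive
  rcases incompatible with h | h
  · simp only [familySample_cons_of_ne h, div_self (hg _), one_div_one]
  · rw [Multiset.cons_swap]
    simp only [familySample_cons_of_ne h]
    exact div_self (div_ne_zero (hg _) (hg _))

theorem familySample_eq_of_map_restrict_eq [DecidableEq V] {D : Finset V}
    (hD : dagFamily 𝔭 s.1 ⊆ D) {n n' : Multiset (∀ v, I v)}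
    (hn : n.map D.restrict = n'.map D.restrict) : familySample 𝔭 s n = familySample 𝔭 s n' := by
  have hpar : 𝔭 s.1 ⊆ D := (Finset.subset_insert _ _).trans hD
  have factor : ∀ n : Multiset (∀ v, I v), familySample 𝔭 s n =
      ((n.map D.restrict).filter fun k => Finset.restrict₂ (π := I) hpar k = s.2).map
        fun k => k ⟨s.1, hD (self_mem_dagFamily 𝔭 s.1)⟩ := by
    intro n
    rw [Multiset.filter_map, Multiset.map_map]
    rfl
  rw [factor, hn, ← factor]

theorem predictiveRatio_comp_familySample_congr {K : Type*} [Div K] [DecidableEq V]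
    {D : Finset V} (hD : dagFamily 𝔭 s.1 ⊆ D) (g : Multiset (I s.1) → K)
    {i i' j j' : ∀ v, I v} {n n' : Multiset (∀ v, I v)}
    (hi : D.restrict i = D.restrict j) (hi' : D.restrict i' = D.restrict j')
    (hn : n.map D.restrict = n'.map D.restrict) :
    predictiveRatio (fun n => g (familySample 𝔭 s n)) i i' n =
      predictiveRatio (fun n => g (familySample 𝔭 s n)) j j' n' := by
  have h : familySample 𝔭 s n = familySample 𝔭 s n' := familySample_eq_of_map_restrict_eq hD hn
  have h₁ : familySample 𝔭 s (i ::ₘ n) = familySample 𝔭 s (j ::ₘ n') :=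
    familySample_eq_of_map_restrict_eq hD (by simp [hi, hn])
  have h₂ : familySample 𝔭 s (i' ::ₘ n) = familySample 𝔭 s (j' ::ₘ n') :=
    familySample_eq_of_map_restrict_eq hD (by simp [hi', hn])
  have h₁₂ : familySample 𝔭 s (i ::ₘ i' ::ₘ n) = familySample 𝔭 s (j ::ₘ j' ::ₘ n') :=
    familySample_eq_of_map_restrict_eq hD (by simp [hi, hi', hn])
  simp only [predictiveRatio, predictive, h, h₁, h₂, h₁₂]

end FamilySample

section FamilyLocal

variable {V : Type*} [DecidableEq V] {I : V → Type*} {K : Type*}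

/-- If the cells `i` and `i'` differ at `w`, then `predictiveRatio M i i' n` depends only on the
marginals of `i`, `i'` and `n` on the family of `w`. -/
def FamilyLocal [Div K] (𝔭 : V → Finset V) (M : Multiset (∀ v, I v) → K) : Prop :=
  ∀ ⦃w : V⦄ ⦃i i' j j' : ∀ v, I v⦄ ⦃n n' : Multiset (∀ v, I v)⦄, i w ≠ i' w →
    (dagFamily 𝔭 w).restrict i = (dagFamily 𝔭 w).restrict j →
    (dagFamily 𝔭 w).restrict i' = (dagFamily 𝔭 w).restrict j' →
    n.map (dagFamily 𝔭 w).restrict = n'.map (dagFamily 𝔭 w).restrict →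
    predictiveRatio M i i' n = predictiveRatio M j j' n'

section Product

variable [CommGroupWithZero K] [∀ v, DecidableEq (I v)] {𝔭 : V → Finset V}

-- The factors of families that do not contain `w` as a parent are determined by the marginals on
-- the family of `w`, because the order is total; the other factors are `1`.
theorem IsVertexNumbering.familyLocal_prod [Fintype V] [∀ v, Fintype (I v)] {d : ℕ}
    {v : Fin d ≃ V} (hv : IsVertexNumbering 𝔭 v)
    {g : (s : (v : V) × (∀ u : 𝔭 v, I u)) → Multiset (I s.1) → K}
    (hg : ∀ s n, g s (familySample 𝔭 s n) ≠ 0) :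
    FamilyLocal 𝔭 fun n => ∏ s, g s (familySample 𝔭 s n) := by
  intro w i i' j j' n n' hw hi hi' hn
  rw [predictiveRatio_prod, predictiveRatio_prod]
  refine Finset.prod_congr rfl fun s _ => ?_
  rcases hv.dagFamily_subset_or_mem_parents w s.1 with hs | hs
  · exact predictiveRatio_comp_familySample_congr hs (g s) hi hi' hn
  · have hjw : j w ≠ j' w := by
      have hself := self_mem_dagFamily 𝔭 w
      rwa [← show i w = j w from congrFun hi ⟨w, hself⟩,
        ← show i' w = j' w from congrFun hi' ⟨w, hself⟩]
    rw [predictiveRatio_comp_familySample_eq_one (hg s) hs hw,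
      predictiveRatio_comp_familySample_eq_one (hg s) hs hjw]

end Product

section TwoOrders

variable [Div K] {𝔭 𝔭' : V → Finset V} {M : Multiset (∀ v, I v) → K}

namespace FamilyLocal

theorem predictiveRatio_update (hM : FamilyLocal 𝔭 M) {w x : V} (hx : x ∉ dagFamily 𝔭 w)
    {i i' : ∀ v, I v} (hw : i w ≠ i' w) (m : I x) (n : Multiset (∀ v, I v)) :
    predictiveRatio M i (Function.update i' x m) n = predictiveRatio M i i' n := by
  refine (hM hw rfl ?_ rfl).symm
  ext ⟨u, hu⟩
  exact (Function.update_of_ne (ne_of_mem_of_not_mem hu hx) m i').symm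

theorem predictiveRatio_congr_root (hM : FamilyLocal 𝔭 M) {a : V} (ha : 𝔭 a = ∅)
    {i i' j j' : ∀ v, I v} {n n' : Multiset (∀ v, I v)} (h : i a ≠ i' a) (hi : i a = j a)
    (hi' : i' a = j' a) (hn : n.map (fun x => x a) = n'.map (fun x => x a)) :
    predictiveRatio M i i' n = predictiveRatio M j j' n' := by
  have mem_family : ∀ u : dagFamily 𝔭 a, u = ⟨a, self_mem_dagFamily 𝔭 a⟩ := by
    rintro ⟨u, hu⟩
    exact Subtype.ext (by simpa [dagFamily, ha] using hu)
  let extend (m : I a) (u : dagFamily 𝔭 a) : I u := mem_family u ▸ m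
  have restrict_eq : ∀ x : ∀ v, I v, (dagFamily 𝔭 a).restrict x = extend (x a) := by
    intro x
    ext u
    rw [mem_family u]
    rfl
  refine hM h (by rw [restrict_eq, restrict_eq, hi]) (by rw [restrict_eq, restrict_eq, hi']) ?_
  rw [funext restrict_eq]
  simpa only [Multiset.map_map, Function.comp_def] using congrArg (Multiset.map extend) hn

-- Make `n` constant at `b` first, which is invisible at the root `a`; the values at `b` of the
-- resulting sample are those of `replicate n.card r`.
theorem predictiveRatio_eq_replicate (hM : FamilyLocal 𝔭 M) (hM' : FamilyLocal 𝔭' M) {a b : V}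
    (hab : a ≠ b) (ha : 𝔭 a = ∅) (hb : 𝔭' b = ∅) {r r' : ∀ v, I v} (hr : r b ≠ r' b)
    {i i' : ∀ v, I v} (hi : i a ≠ i' a) (n : Multiset (∀ v, I v)) :
    predictiveRatio M i i' n = predictiveRatio M r r' (Multiset.replicate n.card r) := by
  trans predictiveRatio M (Function.update i b (r b)) (Function.update i' b (r' b))
    (n.map fun x => Function.update x b (r b))
  · exact hM.predictiveRatio_congr_root ha hi (by simp [hab]) (by simp [hab]) (by simp [hab])
  · exact hM'.predictiveRatio_congr_root hb (by simpa using hr) (by simp) (by simp) (by simp)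

theorem predictiveRatio_eq_of_lt [∀ v, Nontrivial (I v)] {d : ℕ} {v v' : Fin d ≃ V}
    (hM : FamilyLocal 𝔭 M) (hv : IsVertexNumbering 𝔭 v) (hv' : IsVertexNumbering 𝔭' v')
    {t : Fin d} (hne : 𝔭 (v t) ≠ 𝔭' (v' t)) {ρ : ℕ → K}
    (ih : ∀ s < t, ∀ (i i' : ∀ v, I v) n, i (v' s) ≠ i' (v' s) →
      predictiveRatio M i i' n = ρ n.card)
    (i i' : ∀ v, I v) (n : Multiset (∀ v, I v)) (hi : i (v t) ≠ i' (v t)) :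
    predictiveRatio M i i' n = ρ n.card := by
  obtain ⟨s, hst, hs⟩ := hv.exists_lt_notMem_parents hv' hne
  by_cases his : i (v' s) = i' (v' s)
  · have hsfamily : v' s ∉ dagFamily 𝔭 (v t) := by
      rw [dagFamily, Finset.mem_insert, not_or]
      exact ⟨fun h => hi (h ▸ his), hs⟩
    obtain ⟨m, hm⟩ := exists_ne (i (v' s))
    rw [← hM.predictiveRatio_update hsfamily hi m n]
    exact ih s hst _ _ _ (by simpa using hm.symm)
  · exact ih s hst _ _ _ his

theorem exists_predictiveRatio_eq [∀ v, Nontrivial (I v)] {d : ℕ} (hd : 2 ≤ d)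
    {v v' : Fin d ≃ V} (hv : IsVertexNumbering 𝔭 v) (hv' : IsVertexNumbering 𝔭' v')
    (hne : ∀ j : Fin d, 1 ≤ j.val → 𝔭 (v j) ≠ 𝔭' (v' j))
    (hM : FamilyLocal 𝔭 M) (hM' : FamilyLocal 𝔭' M) :
    ∃ ρ : ℕ → K, ∀ (i i' : ∀ v, I v) n, i ≠ i' → predictiveRatio M i i' n = ρ n.card := by
  let zero : Fin d := ⟨0, by omega⟩
  have ha : 𝔭 (v zero) = ∅ := hv.first zero rfl
  have hb : 𝔭' (v' zero) = ∅ := hv'.first zero rfl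
  have hab : v zero ≠ v' zero := by
    intro h
    apply hne ⟨1, hd⟩ le_rfl
    rw [hv.next zero ⟨1, hd⟩ rfl, hv'.next zero ⟨1, hd⟩ rfl, ha, hb, h]
  choose r r' hr using fun v => exists_pair_ne (I v)
  let ρ (N : ℕ) : K := predictiveRatio M r r' (Multiset.replicate N r)
  have ratio_eq : ∀ (t : Fin d) (i i' : ∀ v, I v) n,
      i (v t) ≠ i' (v t) ∨ i (v' t) ≠ i' (v' t) → predictiveRatio M i i' n = ρ n.card := by
    intro t
    induction t using WellFoundedLT.induction with
    | ind t ih =>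
      intro i i' n h
      rcases Nat.eq_zero_or_pos t.val with ht | ht
      · obtain rfl : t = zero := Fin.ext ht
        rcases h with h | h
        · exact hM.predictiveRatio_eq_replicate hM' hab ha hb (hr _) h n
        · exact hM'.predictiveRatio_eq_replicate hM hab.symm hb ha (hr _) h n
      · rcases h with h | h
        · exact hM.predictiveRatio_eq_of_lt hv hv' (hne t ht)
            (fun s hs i i' n h => ih s hs i i' n (Or.inr h)) i i' n h
        · exact hM'.predictiveRatio_eq_of_lt hv' hv (hne t ht).symm
            (fun s hs i i' n h => ih s hs i i' n (Or.inl h)) i i' n h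
  refine ⟨ρ, fun i i' n h => ?_⟩
  obtain ⟨x, hx⟩ := Function.ne_iff.mp h
  obtain ⟨t, rfl⟩ := v.surjective x
  exact ratio_eq t i i' n (Or.inl hx)

end FamilyLocal

end TwoOrders

end FamilyLocal

section Polya

variable {ι K : Type*} [Fintype ι] [Field K] [LinearOrder K]

/-- `M n` is the probability that the first observations of an exchangeable sequence in `ι` are
those of the sample `n`, in any given order; every finite sample is possible. -/
structure IsExchangeableWeight (M : Multiset ι → K) : Prop where
  pos : ∀ n, 0 < M n
  sum_cons : ∀ n, ∑ i, M (i ::ₘ n) = M n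

namespace IsExchangeableWeight

variable {M : Multiset ι → K} {ρ : ℕ → K}

theorem sum_predictive (hM : IsExchangeableWeight M) (n : Multiset ι) :
    ∑ i, predictive M n i = 1 := by
  simp only [predictive, ← Finset.sum_div, hM.sum_cons, div_self (hM.pos n).ne']

variable [IsStrictOrderedRing K]

theorem predictive_pos (hM : IsExchangeableWeight M) (n : Multiset ι) (i : ι) :
    0 < predictive M n i :=
  div_pos (hM.pos _) (hM.pos _)

theorem predictive_le_one (hM : IsExchangeableWeight M) (n : Multiset ι) (i : ι) :
    predictive M n i ≤ 1 :=
  hM.sum_predictive n ▸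
    Finset.single_le_sum (fun j _ => (hM.predictive_pos n j).le) (Finset.mem_univ i)

theorem predictiveRatio_pos (hM : IsExchangeableWeight M) (i j : ι) (n : Multiset ι) :
    0 < predictiveRatio M i j n :=
  div_pos (hM.predictive_pos _ _) (hM.predictive_pos _ _)

theorem predictive_cons_of_ne (hM : IsExchangeableWeight M)
    (hρ : ∀ i j n, i ≠ j → predictiveRatio M i j n = ρ n.card) {i j : ι} (hij : i ≠ j)
    (n : Multiset ι) : predictive M (j ::ₘ n) i = ρ n.card * predictive M n i :=
  (div_eq_iff (hM.predictive_pos n i).ne').mp (hρ i j n hij)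

theorem predictive_cons_self (hM : IsExchangeableWeight M)
    (hρ : ∀ i j n, i ≠ j → predictiveRatio M i j n = ρ n.card) (i : ι) (n : Multiset ι) :
    predictive M (i ::ₘ n) i = 1 - ρ n.card * (1 - predictive M n i) := by
  classical
  have others : ∑ j ∈ Finset.univ.erase i, predictive M (i ::ₘ n) j =
      ρ n.card * ∑ j ∈ Finset.univ.erase i, predictive M n j := by
    rw [Finset.mul_sum]
    exact Finset.sum_congr rfl fun j hj =>
      hM.predictive_cons_of_ne hρ (Finset.ne_of_mem_erase hj) n
  have before := hM.sum_predictive n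
  have after := hM.sum_predictive (i ::ₘ n)
  rw [← Finset.add_sum_erase _ _ (Finset.mem_univ i)] at before after
  linear_combination after - others - ρ n.card * before

-- Extending a sample by `i` and `j ≠ i` in either order leads to the same predictive probability
-- of `i`.
theorem ratio_succ [Nontrivial ι] (hM : IsExchangeableWeight M)
    (hρ : ∀ i j n, i ≠ j → predictiveRatio M i j n = ρ n.card) (N : ℕ) :
    ρ (N + 1) * (2 - ρ N) = 1 := by
  obtain ⟨i, j, hij⟩ := exists_pair_ne ι
  have h := congrArg (predictive M · i) (Multiset.cons_swap i j (.replicate N i))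
  simp only [hM.predictive_cons_self hρ, hM.predictive_cons_of_ne hρ hij, Multiset.card_cons,
    Multiset.card_replicate] at h
  linear_combination -h

theorem ratio_zero_lt_one (hM : IsExchangeableWeight M)
    (hρ : ∀ i j n, i ≠ j → predictiveRatio M i j n = ρ n.card) {i : ι}
    (hi : predictive M 0 i < predictive M {i} i) : ρ 0 < 1 := by
  rw [← Multiset.cons_zero, hM.predictive_cons_self hρ, Multiset.card_zero] at hi
  have hle : 0 ≤ 1 - predictive M 0 i := sub_nonneg.mpr (hM.predictive_le_one 0 i)
  have hmul : 0 < (1 - ρ 0) * (1 - predictive M 0 i) := by linarith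
  exact sub_pos.mp (pos_of_mul_pos_left hmul hle)

end IsExchangeableWeight

variable [IsStrictOrderedRing K]

theorem eq_div_add_one_of_mul_two_sub_eq_one {ρ : ℕ → K} (hρ : ∀ N, ρ (N + 1) * (2 - ρ N) = 1)
    {A : K} (hA : 0 < A) (zero : ρ 0 = A / (A + 1)) (N : ℕ) : ρ N = (A + N) / (A + N + 1) := by
  induction N with
  | zero => simpa using zero
  | succ N ih =>
    have : 0 < A + N := add_pos_of_pos_of_nonneg hA N.cast_nonneg
    have h := hρ N
    rw [ih] at h
    field_simp at h
    rw [Nat.cast_succ, eq_div_iff (by linarith)]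
    linear_combination h

theorem IsExchangeableWeight.exists_predictive_eq [Nontrivial ι] [DecidableEq ι]
    {M : Multiset ι → K} (hM : IsExchangeableWeight M) {ρ : ℕ → K}
    (hρ : ∀ i j n, i ≠ j → predictiveRatio M i j n = ρ n.card)
    (hlt : ∃ i, predictive M 0 i < predictive M {i} i) :
    ∃ α : ι → K, (∀ i, 0 < α i) ∧
      ∀ n i, predictive M n i = (α i + n.count i) / (∑ j, α j + n.card) := by
  obtain ⟨i₀, hi₀⟩ := hlt
  obtain ⟨i₁, hi₁⟩ := exists_ne i₀
  have hpos : 0 < ρ 0 := by simpa [hρ i₁ i₀ 0 hi₁] using hM.predictiveRatio_pos i₁ i₀ 0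
  have hlt : 0 < 1 - ρ 0 := sub_pos.mpr (hM.ratio_zero_lt_one hρ hi₀)
  set A := ρ 0 / (1 - ρ 0) with hA
  have hApos : 0 < A := div_pos hpos hlt
  have hρA : ∀ N, ρ N = (A + N) / (A + N + 1) :=
    eq_div_add_one_of_mul_two_sub_eq_one (hM.ratio_succ hρ) hApos (by rw [hA]; field_simp; ring)
  refine ⟨fun i => A * predictive M 0 i, fun i => mul_pos hApos (hM.predictive_pos 0 i), ?_⟩
  rw [← Finset.mul_sum, hM.sum_predictive, mul_one]
  intro n i
  induction n using Multiset.induction with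
  | empty => simp [hApos.ne']
  | cons j n ih =>
    have : 0 < A + n.card := add_pos_of_pos_of_nonneg hApos (Nat.cast_nonneg _)
    rcases eq_or_ne i j with rfl | hij
    · rw [hM.predictive_cons_self hρ, hρA, ih, Multiset.count_cons_self, Multiset.card_cons,
        Nat.cast_succ, Nat.cast_succ]
      field_simp
      ring
    · rw [hM.predictive_cons_of_ne hρ hij, hρA, ih, Multiset.count_cons_of_ne hij,
        Multiset.card_cons, Nat.cast_succ]
      field_simp
      ring

end Polya

section DirichletMoment

variable {ι : Type*} [Fintype ι] [DecidableEq ι]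

/-- The mixed moment `E[∏_{i ∈ n} Y i]` of a Dirichlet vector `Y` with parameters `α`. -/
noncomputable def dirichletMoment (α : ι → ℝ) (n : Multiset ι) : ℝ :=
  Real.Gamma (∑ i, α i) / (∏ i, Real.Gamma (α i)) *
    ((∏ i, Real.Gamma (α i + n.count i)) / Real.Gamma (∑ i, α i + n.card))

variable {α : ι → ℝ}

theorem dirichletMoment_zero [Nonempty ι] (hα : ∀ i, 0 < α i) : dirichletMoment α 0 = 1 := by
  have hsum : 0 < ∑ i, α i := Finset.sum_pos (fun i _ => hα i) Finset.univ_nonempty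
  have hprod : ∏ i, Real.Gamma (α i) ≠ 0 :=
    Finset.prod_ne_zero_iff.mpr fun i _ => (Real.Gamma_pos_of_pos (hα i)).ne'
  have hGamma := (Real.Gamma_pos_of_pos hsum).ne'
  simp only [dirichletMoment, Multiset.count_zero, Multiset.card_zero, Nat.cast_zero, add_zero]
  field_simp

theorem dirichletMoment_cons (hα : ∀ i, 0 < α i) (i : ι) (n : Multiset ι) :
    dirichletMoment α (i ::ₘ n) =
      (α i + n.count i) / (∑ j, α j + n.card) * dirichletMoment α n := by
  have hi : 0 < α i + n.count i := add_pos_of_pos_of_nonneg (hα i) (Nat.cast_nonneg _)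
  have hsum : 0 < ∑ j, α j + n.card := add_pos_of_pos_of_nonneg
    (Finset.sum_pos (fun j _ => hα j) ⟨i, Finset.mem_univ i⟩) (Nat.cast_nonneg _)
  have hprod : ∏ j, Real.Gamma (α j + (i ::ₘ n).count j) =
      (α i + n.count i) * ∏ j, Real.Gamma (α j + n.count j) := by
    rw [← Finset.mul_prod_erase _ _ (Finset.mem_univ i),
      ← Finset.mul_prod_erase _ (fun j => Real.Gamma (α j + n.count j)) (Finset.mem_univ i),
      ← mul_assoc, Multiset.count_cons_self, Nat.cast_succ, ← add_assoc,
      Real.Gamma_add_one hi.ne']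
    congr 1
    refine Finset.prod_congr rfl fun j hj => ?_
    rw [Multiset.count_cons_of_ne (Finset.ne_of_mem_erase hj)]
  simp only [dirichletMoment, hprod, Multiset.card_cons, Nat.cast_succ, ← add_assoc,
    Real.Gamma_add_one hsum.ne']
  field_simp

theorem IsExchangeableWeight.eq_dirichletMoment [Nonempty ι] {M : Multiset ι → ℝ}
    (hM : IsExchangeableWeight M) (zero : M 0 = 1) (hα : ∀ i, 0 < α i)
    (hpred : ∀ n i, predictive M n i = (α i + n.count i) / (∑ j, α j + n.card))
    (n : Multiset ι) : M n = dirichletMoment α n := by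
  induction n using Multiset.induction with
  | empty => rw [zero, dirichletMoment_zero hα]
  | cons i n ih =>
    rw [dirichletMoment_cons hα, ← hpred, ← ih, predictive, div_mul_cancel₀ _ (hM.pos n).ne']

end DirichletMoment

section LintegralPi

variable {κ : Type*} {X : κ → Type*} [∀ j, MeasurableSpace (X j)] {μ : ∀ j, Measure (X j)}
  [∀ j, SigmaFinite (μ j)] {f : ∀ j, X j → ENNReal}

theorem lmarginal_prod_eq_prod [DecidableEq κ] (hf : ∀ j, Measurable (f j)) (s : Finset κ)
    (x : ∀ j, X j) :
    (∫⋯∫⁻_s, fun y => ∏ j ∈ s, f j (y j) ∂μ) x = ∏ j ∈ s, ∫⁻ t, f j t ∂μ j := by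
  have measurable_prod : ∀ s : Finset κ, Measurable fun y : ∀ j, X j => ∏ j ∈ s, f j (y j) :=
    fun s => Finset.measurable_prod _ fun j _ => (hf j).comp (measurable_pi_apply j)
  induction s using Finset.induction_on with
  | empty => simp
  | insert i s hi ih =>
    have inner : ∀ y : ∀ j, X j,
        ∫⁻ t, ∏ j ∈ insert i s, f j (Function.update y i t j) ∂μ i =
          (∫⁻ t, f i t ∂μ i) * ∏ j ∈ s, f j (y j) := by
      intro y
      rw [← lintegral_mul_const _ (hf i)]
      refine lintegral_congr fun t => ?_
      rw [Finset.prod_insert hi, Function.update_self]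
      congr 1
      exact Finset.prod_congr rfl fun j hj => by
        rw [Function.update_of_ne (ne_of_mem_of_not_mem hj hi)]
    rw [lmarginal_insert' _ (measurable_prod _) hi, Finset.prod_insert hi, ← ih]
    simp only [inner]
    exact lintegral_const_mul _ ((measurable_prod s).comp measurable_updateFinset)

theorem lintegral_fintype_prod_eq_prod [Fintype κ] (hf : ∀ j, Measurable (f j)) :
    ∫⁻ y, ∏ j, f j (y j) ∂Measure.pi μ = ∏ j, ∫⁻ t, f j t ∂μ j := by
  classical
  rcases isEmpty_or_nonempty (∀ j, X j) with h | ⟨⟨x⟩⟩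
  · obtain ⟨j, hj⟩ := isEmpty_pi.mp h
    rw [lintegral_of_isEmpty, Finset.prod_eq_zero (Finset.mem_univ j) (lintegral_of_isEmpty _ _)]
  · rw [lintegral_eq_lmarginal_univ x, lmarginal_prod_eq_prod hf]

end LintegralPi

section DirichletIntegral

/-- The power function `y ↦ y ^ (a - 1)` on the positive half-line, extended by zero. -/
noncomputable def posPow (a y : ℝ) : ENNReal :=
  (Set.Ioi (0 : ℝ)).indicator (fun y => ENNReal.ofReal (y ^ (a - 1))) y

@[fun_prop]
theorem measurable_posPow (a : ℝ) : Measurable (posPow a) :=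
  Measurable.indicator (by fun_prop) measurableSet_Ioi

theorem posPow_of_nonpos (a : ℝ) {y : ℝ} (hy : y ≤ 0) : posPow a y = 0 :=
  Set.indicator_of_notMem (Set.notMem_Ioi.mpr hy) _

theorem posPow_of_pos (a : ℝ) {y : ℝ} (hy : 0 < y) : posPow a y = ENNReal.ofReal (y ^ (a - 1)) :=
  Set.indicator_of_mem hy _

theorem posPow_mul (a : ℝ) {s : ℝ} (hs : 0 < s) (y : ℝ) :
    posPow a (s * y) = ENNReal.ofReal (s ^ (a - 1)) * posPow a y := by
  rcases le_or_gt y 0 with hy | hy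
  · rw [posPow_of_nonpos a hy, posPow_of_nonpos a (mul_nonpos_of_nonneg_of_nonpos hs.le hy),
      mul_zero]
  · rw [posPow_of_pos a hy, posPow_of_pos a (mul_pos hs hy), Real.mul_rpow hs.le hy.le,
      ENNReal.ofReal_mul (by positivity)]

theorem lintegral_posPow_mul_exp_neg {a : ℝ} (ha : 0 < a) :
    ∫⁻ y, posPow a y * ENNReal.ofReal (Real.exp (-y)) = ENNReal.ofReal (Real.Gamma a) := by
  rw [Real.Gamma_eq_integral ha, ofReal_integral_eq_lintegral_ofReal
    (Real.GammaIntegral_convergent ha), ← lintegral_indicator measurableSet_Ioi]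
  · refine lintegral_congr fun y => ?_
    rcases le_or_gt y 0 with hy | hy
    · rw [Set.indicator_of_notMem (Set.notMem_Ioi.mpr hy), posPow_of_nonpos a hy, zero_mul]
    · rw [Set.indicator_of_mem (Set.mem_Ioi.mpr hy), posPow_of_pos a hy, mul_comm,
        ← ENNReal.ofReal_mul (Real.exp_pos _).le]
  · filter_upwards [self_mem_ae_restrict measurableSet_Ioi] with y hy
    have : 0 < y := hy
    positivity

section SimplexKernel

variable {κ : Type*} [Fintype κ] (a : κ → ℝ) (a₀ : ℝ)

/-- The unnormalised Dirichlet density with parameters `a₀` and `a` on the simplex of size `s`, in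
the coordinates with parameters `a`. -/
noncomputable def simplexKernel (s : ℝ) (y : κ → ℝ) : ENNReal :=
  posPow a₀ (s - ∑ j, y j) * ∏ j, posPow (a j) (y j)

theorem measurable_uncurry_simplexKernel :
    Measurable fun z : ℝ × (κ → ℝ) => simplexKernel a a₀ z.1 z.2 := by
  unfold simplexKernel
  fun_prop

theorem measurable_simplexKernel (s : ℝ) : Measurable (simplexKernel a a₀ s) :=
  (measurable_uncurry_simplexKernel a a₀).comp measurable_prodMk_left

theorem simplexKernel_of_nonpos {s : ℝ} (hs : s ≤ 0) (y : κ → ℝ) :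
    simplexKernel a a₀ s y = 0 := by
  unfold simplexKernel
  by_cases! hy : ∀ j, 0 < y j
  · have hsum : 0 ≤ ∑ j, y j := Finset.sum_nonneg fun j _ => (hy j).le
    rw [posPow_of_nonpos _ (by linarith), zero_mul]
  · obtain ⟨j, hj⟩ := hy
    rw [Finset.prod_eq_zero (Finset.mem_univ j) (posPow_of_nonpos _ hj), mul_zero]

theorem simplexKernel_smul {s : ℝ} (hs : 0 < s) (y : κ → ℝ) :
    simplexKernel a a₀ s (s • y) =
      ENNReal.ofReal (s ^ (a₀ + ∑ j, a j - 1 - Fintype.card κ)) * simplexKernel a a₀ 1 y := by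
  have hsub : s - ∑ j, (s • y) j = s * (1 - ∑ j, y j) := by
    simp only [Pi.smul_apply, smul_eq_mul, ← Finset.mul_sum, mul_sub, mul_one]
  have hexp : a₀ - 1 + ∑ j, (a j - 1) = a₀ + ∑ j, a j - 1 - Fintype.card κ := by
    simp only [Finset.sum_sub_distrib, Finset.sum_const, Finset.card_univ, nsmul_eq_mul, mul_one]
    ring
  rw [simplexKernel, hsub, posPow_mul _ hs]
  simp only [Pi.smul_apply, smul_eq_mul, posPow_mul _ hs, Finset.prod_mul_distrib]
  rw [← ENNReal.ofReal_prod_of_nonneg fun j _ => by positivity, mul_mul_mul_comm,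
    ← ENNReal.ofReal_mul (by positivity), ← Real.rpow_sum_of_pos hs, ← Real.rpow_add hs, hexp,
    simplexKernel]

theorem lintegral_simplexKernel_eq_posPow_mul (s : ℝ) :
    ∫⁻ y, simplexKernel a a₀ s y =
      posPow (a₀ + ∑ j, a j) s * ∫⁻ y, simplexKernel a a₀ 1 y := by
  rcases le_or_gt s 0 with hs | hs
  · simp [simplexKernel_of_nonpos _ _ hs, posPow_of_nonpos _ hs]
  have hpow : 0 < s ^ Fintype.card κ := by positivity
  have scaling : ∫⁻ y, simplexKernel a a₀ s (s • y) =
      ENNReal.ofReal (s ^ Fintype.card κ)⁻¹ * ∫⁻ y, simplexKernel a a₀ s y := by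
    rw [← lintegral_map (measurable_simplexKernel a a₀ s) (measurable_const_smul s),
      Measure.map_addHaar_smul _ hs.ne', lintegral_smul_measure, Module.finrank_fintype_fun_eq_card,
      abs_of_pos (inv_pos.mpr hpow), smul_eq_mul]
  simp only [simplexKernel_smul _ _ hs] at scaling
  rw [lintegral_const_mul _ (measurable_simplexKernel a a₀ 1), ENNReal.ofReal_inv_of_pos hpow,
    ← ENNReal.div_eq_inv_mul, ENNReal.eq_div_iff (by simpa using hpow) ENNReal.ofReal_ne_top,
    ← mul_assoc, ← ENNReal.ofReal_mul hpow.le, ← Real.rpow_natCast, ← Real.rpow_add hs] at scaling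
  rw [← scaling, posPow_of_pos _ hs]
  congr 3
  ring

theorem lintegral_simplexKernel_mul_exp_neg (y : κ → ℝ) :
    ∫⁻ s, simplexKernel a a₀ s y * ENNReal.ofReal (Real.exp (-s)) =
      (∫⁻ t, posPow a₀ t * ENNReal.ofReal (Real.exp (-t))) *
        ∏ j, posPow (a j) (y j) * ENNReal.ofReal (Real.exp (-y j)) := by
  rw [← lintegral_sub_right_eq_self
    (fun t => posPow a₀ t * ENNReal.ofReal (Real.exp (-t))) (∑ j, y j),
    ← lintegral_mul_const _ (by fun_prop)]
  refine lintegral_congr fun s => ?_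
  have hexp : -s = -(s - ∑ j, y j) + ∑ j, -y j := by
    rw [Finset.sum_neg_distrib]
    ring
  rw [hexp, Real.exp_add, Real.exp_sum, ENNReal.ofReal_mul (by positivity),
    ENNReal.ofReal_prod_of_nonneg fun j _ => (Real.exp_pos _).le, simplexKernel,
    mul_mul_mul_comm, Finset.prod_mul_distrib]

variable {a a₀}

-- Integrate `simplexKernel a a₀ s y * exp (-s)` over `s` and `y` in both orders.
theorem Gamma_mul_lintegral_simplexKernel (ha : ∀ j, 0 < a j) (ha₀ : 0 < a₀) :
    ENNReal.ofReal (Real.Gamma (a₀ + ∑ j, a j)) * ∫⁻ y, simplexKernel a a₀ 1 y =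
      ENNReal.ofReal (Real.Gamma a₀ * ∏ j, Real.Gamma (a j)) := by
  have hsum : 0 < a₀ + ∑ j, a j :=
    add_pos_of_pos_of_nonneg ha₀ (Finset.sum_nonneg fun j _ => (ha j).le)
  have hkernel := measurable_uncurry_simplexKernel a a₀
  calc
    _ = ∫⁻ s, ∫⁻ y, simplexKernel a a₀ s y * ENNReal.ofReal (Real.exp (-s)) := by
      rw [← lintegral_posPow_mul_exp_neg hsum, ← lintegral_mul_const _ (by fun_prop)]
      refine lintegral_congr fun s => ?_
      rw [lintegral_mul_const _ (measurable_simplexKernel a a₀ s),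
        lintegral_simplexKernel_eq_posPow_mul a a₀ s, mul_right_comm]
    _ = ∫⁻ y, ∫⁻ s, simplexKernel a a₀ s y * ENNReal.ofReal (Real.exp (-s)) :=
      lintegral_lintegral_swap (hkernel.mul (by fun_prop)).aemeasurable
    _ = _ := by
      simp only [lintegral_simplexKernel_mul_exp_neg]
      rw [lintegral_const_mul _ (by fun_prop), volume_pi, lintegral_fintype_prod_eq_prod
        (f := fun j y => posPow (a j) y * ENNReal.ofReal (Real.exp (-y))) (by fun_prop),
        ENNReal.ofReal_mul (Real.Gamma_pos_of_pos ha₀).le,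
        ENNReal.ofReal_prod_of_nonneg fun j _ => (Real.Gamma_pos_of_pos (ha j)).le]
      simp only [lintegral_posPow_mul_exp_neg, ha, ha₀]

end SimplexKernel

end DirichletIntegral

section MomentProblem

open scoped BoundedContinuousFunction

-- The monomials in the functions `f i` span a subalgebra that separates points.
theorem ext_of_integral_multiset_prod_eq {X ι : Type*} [TopologicalSpace X] [PolishSpace X]
    [MeasurableSpace X] [BorelSpace X] {μ ν : Measure X} [IsFiniteMeasure μ] [IsFiniteMeasure ν]
    {f : ι → X →ᵇ ℝ} (hf : ∀ ⦃x y⦄, x ≠ y → ∃ i, f i x ≠ f i y)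
    (h : ∀ n : Multiset ι, ∫ x, (n.map fun i => f i x).prod ∂μ =
      ∫ x, (n.map fun i => f i x).prod ∂ν) : μ = ν := by
  refine ext_of_forall_mem_subalgebra_integral_eq_of_polish (𝕜 := ℝ)
    (A := StarAlgebra.adjoin ℝ (Set.range f)) (fun x y hxy => ?_) fun g hg => ?_
  · obtain ⟨i, hi⟩ := hf hxy
    exact ⟨f i, ⟨_, ⟨f i, StarAlgebra.subset_adjoin ℝ _ ⟨i, rfl⟩, rfl⟩, rfl⟩, hi⟩
  · have star_range : star (Set.range f) = Set.range f := by
      have hstar : (star : (X →ᵇ ℝ) → X →ᵇ ℝ) = id := by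
        ext g x
        exact star_trivial (g x)
      rw [← Set.image_star, hstar, Set.image_id]
    have hspan : g ∈ Submodule.span ℝ (Submonoid.closure (Set.range f) : Set (X →ᵇ ℝ)) := by
      rw [← Set.union_self (Set.range f)]
      nth_rw 2 [← star_range]
      rwa [← StarAlgebra.adjoin_eq_span]
    clear hg
    induction hspan using Submodule.span_induction with
    | mem g hg =>
      have monomial : ∃ n : Multiset ι, ∀ x, g x = (n.map fun i => f i x).prod := by
        induction hg using Submonoid.closure_induction with
        | mem g hg =>
          obtain ⟨i, rfl⟩ := hg
          exact ⟨{i}, by simp⟩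
        | one => exact ⟨0, by simp⟩
        | mul g g' _ _ ih ih' =>
          obtain ⟨n, hn⟩ := ih
          obtain ⟨n', hn'⟩ := ih'
          exact ⟨n + n', by simp [hn, hn']⟩
      obtain ⟨n, hn⟩ := monomial
      simp only [hn, h]
    | zero => simp
    | add g g' _ _ ih ih' =>
      simp only [BoundedContinuousFunction.add_apply]
      rw [integral_add (g.integrable μ) (g'.integrable μ),
        integral_add (g.integrable ν) (g'.integrable ν), ih, ih']
    | smul c g _ ih =>
      simp only [BoundedContinuousFunction.smul_apply, integral_smul, ih]

variable {ι : Type*} {μ ν : Measure (ι → ℝ)}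

/-- The mixed moment `∫ y, ∏_{i ∈ n} y i ∂μ`. Indexing by multisets, it is the probability that
the first observations are those of the sample `n` when, given `y`, the observations are
independent with probabilities `y`. -/
noncomputable def mixedMoment (μ : Measure (ι → ℝ)) (n : Multiset ι) : ℝ :=
  ∫ y, (n.map y).prod ∂μ

theorem continuous_multiset_prod_map (n : Multiset ι) :
    Continuous fun y : ι → ℝ => (n.map y).prod :=
  continuous_multiset_prod n fun i _ => continuous_apply i

theorem mixedMoment_map [Countable ι] {Ω : Type*} [MeasurableSpace Ω] {P : Measure Ω}
    {Y : Ω → ι → ℝ} (hY : AEMeasurable Y P) (n : Multiset ι) :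
    mixedMoment (P.map Y) n = ∫ ω, (n.map (Y ω)).prod ∂P :=
  integral_map hY (continuous_multiset_prod_map n).aestronglyMeasurable

theorem mixedMoment_zero [IsProbabilityMeasure μ] : mixedMoment μ 0 = 1 := by
  simp [mixedMoment]

theorem integrable_multiset_prod_map [Countable ι] [IsFiniteMeasure μ] {K : Set (ι → ℝ)}
    (hK : IsCompact K) (hμ : ∀ᵐ y ∂μ, y ∈ K) (n : Multiset ι) :
    Integrable (fun y => (n.map y).prod) μ := by
  rw [← Measure.restrict_eq_self_of_ae_mem hμ]
  exact (continuous_multiset_prod_map n).continuousOn.integrableOn_compact hK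

theorem ext_of_mixedMoment_eq [Countable ι] [IsFiniteMeasure μ] [IsFiniteMeasure ν]
    {K : Set (ι → ℝ)} (hK : IsCompact K) (hμ : ∀ᵐ y ∂μ, y ∈ K) (hν : ∀ᵐ y ∂ν, y ∈ K)
    (h : ∀ n, mixedMoment μ n = mixedMoment ν n) : μ = ν := by
  have := hK.isClosed.polishSpace
  have := isCompact_iff_compactSpace.mp hK
  have hmeas := hK.isClosed.measurableSet
  let coord (i : ι) : K →ᵇ ℝ :=
    BoundedContinuousFunction.mkOfCompact
      ⟨fun y => y.1 i, (continuous_apply i).comp continuous_subtype_val⟩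
  have hcomap : μ.comap ((↑) : K → ι → ℝ) = ν.comap (↑) := by
    refine ext_of_integral_multiset_prod_eq (f := coord) (fun x y hxy => ?_) fun n => ?_
    · exact Function.ne_iff.mp (Subtype.coe_ne_coe.mpr hxy)
    · have h := h n
      simp only [mixedMoment] at h
      rw [← Measure.restrict_eq_self_of_ae_mem hμ, ← Measure.restrict_eq_self_of_ae_mem hν,
        ← integral_subtype_comap hmeas, ← integral_subtype_comap hmeas] at h
      exact h
  rw [← Measure.restrict_eq_self_of_ae_mem hμ, ← Measure.restrict_eq_self_of_ae_mem hν,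
    ← map_comap_subtype_coe hmeas, hcomap, map_comap_subtype_coe hmeas]

end MomentProblem

section DirichletMeasure

variable {ι : Type*} [Fintype ι]

theorem Gamma_sum_div_prod_Gamma_nonneg {α : ι → ℝ} (hα : ∀ i, 0 < α i) :
    0 ≤ Real.Gamma (∑ i, α i) / ∏ i, Real.Gamma (α i) :=
  div_nonneg (Real.Gamma_nonneg_of_nonneg (Finset.sum_nonneg fun i _ => (hα i).le))
    (Finset.prod_nonneg fun i _ => (Real.Gamma_pos_of_pos (hα i)).le)

variable [DecidableEq ι]

theorem dirichletMoment_nonneg {α : ι → ℝ} (hα : ∀ i, 0 < α i) (n : Multiset ι) :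
    0 ≤ dirichletMoment α n := by
  refine mul_nonneg (Gamma_sum_div_prod_Gamma_nonneg hα) (div_nonneg
    (Finset.prod_nonneg fun i _ => Real.Gamma_nonneg_of_nonneg ?_)
    (Real.Gamma_nonneg_of_nonneg ?_))
  · exact add_nonneg (hα i).le (Nat.cast_nonneg _)
  · exact add_nonneg (Finset.sum_nonneg fun i _ => (hα i).le) (Nat.cast_nonneg _)

theorem prod_map_eq_prod_pow_count {M : Type*} [CommMonoid M] (n : Multiset ι) (f : ι → M) :
    (n.map f).prod = ∏ i, f i ^ n.count i := by
  rw [Finset.prod_multiset_map_count]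
  refine Finset.prod_subset (Finset.subset_univ _) fun i _ hi => ?_
  rw [Multiset.count_eq_zero_of_notMem (Multiset.mem_toFinset.not.mp hi), pow_zero]

theorem prod_posPow_mul_ofReal_prod_map (α y : ι → ℝ) (n : Multiset ι) :
    (∏ i, posPow (α i) (y i)) * ENNReal.ofReal (n.map y).prod =
      ∏ i, posPow (α i + n.count i) (y i) := by
  by_cases! hy : ∀ i, 0 < y i
  · rw [prod_map_eq_prod_pow_count, ENNReal.ofReal_prod_of_nonneg fun i _ => pow_nonneg (hy i).le _,
      ← Finset.prod_mul_distrib]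
    refine Finset.prod_congr rfl fun i _ => ?_
    rw [posPow_of_pos _ (hy i), posPow_of_pos _ (hy i),
      ← ENNReal.ofReal_mul (Real.rpow_nonneg (hy i).le _), ← Real.rpow_natCast,
      ← Real.rpow_add (hy i), add_sub_right_comm]
  · obtain ⟨i, hi⟩ := hy
    rw [Finset.prod_eq_zero (Finset.mem_univ i) (posPow_of_nonpos _ hi),
      Finset.prod_eq_zero (Finset.mem_univ i) (posPow_of_nonpos _ hi), zero_mul]

section Completion

variable (i₀ : ι) (x : {i : ι // i ≠ i₀} → ℝ)

theorem simplexCompletion_self : simplexCompletion i₀ x i₀ = 1 - ∑ j, x j :=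
  dif_pos rfl

theorem simplexCompletion_coe (j : {i : ι // i ≠ i₀}) : simplexCompletion i₀ x j = x j :=
  dif_neg j.2

theorem sum_simplexCompletion : ∑ i, simplexCompletion i₀ x i = 1 := by
  rw [Fintype.sum_eq_add_sum_subtype_ne _ i₀, simplexCompletion_self]
  simp only [simplexCompletion_coe, sub_add_cancel]

theorem simplexKernel_one_eq_prod_posPow (α : ι → ℝ) :
    simplexKernel (fun j : {i : ι // i ≠ i₀} => α j) (α i₀) 1 x =
      ∏ i, posPow (α i) (simplexCompletion i₀ x i) := by
  rw [Fintype.prod_eq_mul_prod_subtype_ne _ i₀, simplexCompletion_self, simplexKernel]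
  simp only [simplexCompletion_coe]

variable {i₀ x}

theorem mem_openSimplex_iff : x ∈ openSimplex i₀ ↔ ∀ i, 0 < simplexCompletion i₀ x i := by
  constructor
  · rintro ⟨hx, hsum⟩ i
    unfold simplexCompletion
    split_ifs with hi
    · exact sub_pos.mpr hsum
    · exact (hx _).1
  · intro h
    have hsum : ∑ j, x j < 1 := by simpa [simplexCompletion_self] using h i₀
    have hpos : ∀ j, 0 < x j := fun j => by simpa [simplexCompletion_coe] using h j
    exact ⟨fun j => ⟨hpos j, (Finset.single_le_sum (fun j _ => (hpos j).le)
      (Finset.mem_univ j)).trans_lt hsum⟩, hsum⟩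

end Completion

theorem measurableSet_openSimplex (i₀ : ι) : MeasurableSet (openSimplex i₀) := by
  have hpos : openSimplex i₀ = ⋂ i, {x | 0 < simplexCompletion i₀ x i} := by
    ext x
    simp only [mem_openSimplex_iff, Set.mem_iInter, Set.mem_ofPred_eq]
  rw [hpos]
  exact MeasurableSet.iInter fun i => measurableSet_lt measurable_const
    ((measurable_pi_apply i).comp (measurable_simplexCompletion i₀))

theorem measurable_dirichletDensity (α : ι → ℝ) (i₀ : ι) :
    Measurable (dirichletDensity α i₀) := by
  have hcompletion := measurable_simplexCompletion i₀
  exact Measurable.indicator (by fun_prop) (measurableSet_openSimplex i₀)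

theorem ae_mem_stdSimplex_dirichletMeasure (α : ι → ℝ) (i₀ : ι) :
    ∀ᵐ y ∂dirichletMeasure α i₀, y ∈ stdSimplex ℝ ι := by
  have hclosed := isClosed_stdSimplex ℝ ι
  rw [dirichletMeasure, ae_map_iff (p := (· ∈ stdSimplex ℝ ι))
    (measurable_simplexCompletion i₀).aemeasurable hclosed.measurableSet,
    ae_withDensity_iff (measurable_dirichletDensity α i₀).ennreal_ofReal]
  refine Filter.Eventually.of_forall fun x hx => ?_
  have hmem : x ∈ openSimplex i₀ := by
    by_contra hmem
    exact hx (by rw [dirichletDensity, Set.indicator_of_notMem hmem, ENNReal.ofReal_zero])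
  exact ⟨fun i => (mem_openSimplex_iff.mp hmem i).le, sum_simplexCompletion i₀ x⟩

theorem lintegral_prod_posPow_simplexCompletion {α : ι → ℝ} (hα : ∀ i, 0 < α i) (i₀ : ι) :
    ∫⁻ x, ∏ i, posPow (α i) (simplexCompletion i₀ x i) =
      ENNReal.ofReal ((∏ i, Real.Gamma (α i)) / Real.Gamma (∑ i, α i)) := by
  have hGamma : 0 < Real.Gamma (∑ i, α i) :=
    Real.Gamma_pos_of_pos (Finset.sum_pos (fun i _ => hα i) ⟨i₀, Finset.mem_univ i₀⟩)
  rw [ENNReal.ofReal_div_of_pos hGamma, ENNReal.eq_div_iff (by simpa using hGamma)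
    ENNReal.ofReal_ne_top, Fintype.sum_eq_add_sum_subtype_ne _ i₀,
    Fintype.prod_eq_mul_prod_subtype_ne (fun i => Real.Gamma (α i)) i₀]
  simp only [← simplexKernel_one_eq_prod_posPow]
  exact Gamma_mul_lintegral_simplexKernel (fun j : {i : ι // i ≠ i₀} => hα j) (hα i₀)

theorem ofReal_dirichletDensity {α : ι → ℝ} (hα : ∀ i, 0 < α i) (i₀ : ι)
    (x : {i : ι // i ≠ i₀} → ℝ) :
    ENNReal.ofReal (dirichletDensity α i₀ x) =
      ENNReal.ofReal (Real.Gamma (∑ i, α i) / ∏ i, Real.Gamma (α i)) *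
        ∏ i, posPow (α i) (simplexCompletion i₀ x i) := by
  unfold dirichletDensity
  by_cases hx : x ∈ openSimplex i₀
  · have hpos := mem_openSimplex_iff.mp hx
    rw [Set.indicator_of_mem hx, ENNReal.ofReal_mul (Gamma_sum_div_prod_Gamma_nonneg hα),
      ENNReal.ofReal_prod_of_nonneg fun i _ => Real.rpow_nonneg (hpos i).le _]
    simp only [posPow_of_pos, hpos]
  · obtain ⟨i, hi⟩ := not_forall.mp (mem_openSimplex_iff.not.mp hx)
    have hzero := posPow_of_nonpos (α i) (not_lt.mp hi)
    rw [Set.indicator_of_notMem hx, ENNReal.ofReal_zero,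
      Finset.prod_eq_zero (f := fun i => posPow (α i) (simplexCompletion i₀ x i))
        (Finset.mem_univ i) hzero, mul_zero]

theorem lintegral_dirichletMeasure {α : ι → ℝ} (hα : ∀ i, 0 < α i) (i₀ : ι)
    {f : (ι → ℝ) → ENNReal} (hf : Measurable f) :
    ∫⁻ y, f y ∂dirichletMeasure α i₀ =
      ENNReal.ofReal (Real.Gamma (∑ i, α i) / ∏ i, Real.Gamma (α i)) *
        ∫⁻ x, (∏ i, posPow (α i) (simplexCompletion i₀ x i)) * f (simplexCompletion i₀ x) := by
  have hcomp : Measurable fun x => f (simplexCompletion i₀ x) :=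
    hf.comp (measurable_simplexCompletion i₀)
  rw [dirichletMeasure, lintegral_map hf (measurable_simplexCompletion i₀),
    lintegral_withDensity_eq_lintegral_mul _
      (measurable_dirichletDensity α i₀).ennreal_ofReal hcomp,
    ← lintegral_const_mul' _ _ ENNReal.ofReal_ne_top]
  simp only [Pi.mul_apply, ofReal_dirichletDensity hα, mul_assoc]

theorem lintegral_prod_map_dirichletMeasure {α : ι → ℝ} (hα : ∀ i, 0 < α i) (i₀ : ι)
    (n : Multiset ι) :
    ∫⁻ y, ENNReal.ofReal (n.map y).prod ∂dirichletMeasure α i₀ =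
      ENNReal.ofReal (dirichletMoment α n) := by
  have hshift : ∀ i, 0 < α i + n.count i := fun i =>
    add_pos_of_pos_of_nonneg (hα i) (Nat.cast_nonneg _)
  have hcard : ∑ i, (α i + n.count i) = ∑ i, α i + n.card := by
    rw [Finset.sum_add_distrib, ← Nat.cast_sum, Multiset.sum_count_eq_card]
    exact fun i _ => Finset.mem_univ i
  rw [lintegral_dirichletMeasure hα i₀ (continuous_multiset_prod_map n).measurable.ennreal_ofReal]
  simp only [prod_posPow_mul_ofReal_prod_map]
  rw [lintegral_prod_posPow_simplexCompletion hshift, hcard,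
    ← ENNReal.ofReal_mul (Gamma_sum_div_prod_Gamma_nonneg hα), dirichletMoment]

theorem isProbabilityMeasure_dirichletMeasure {α : ι → ℝ} (hα : ∀ i, 0 < α i) (i₀ : ι) :
    IsProbabilityMeasure (dirichletMeasure α i₀) := by
  have : Nonempty ι := ⟨i₀⟩
  have h := lintegral_prod_map_dirichletMeasure hα i₀ 0
  rw [dirichletMoment_zero hα] at h
  exact ⟨by simpa using h⟩

theorem mixedMoment_dirichletMeasure {α : ι → ℝ} (hα : ∀ i, 0 < α i) (i₀ : ι)
    (n : Multiset ι) : mixedMoment (dirichletMeasure α i₀) n = dirichletMoment α n := by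
  have hnonneg : ∀ᵐ y ∂dirichletMeasure α i₀, 0 ≤ (n.map y).prod := by
    filter_upwards [ae_mem_stdSimplex_dirichletMeasure α i₀] with y hy
    exact Multiset.prod_map_nonneg fun i _ => hy.1 i
  rw [mixedMoment, integral_eq_lintegral_of_nonneg_ae hnonneg
      (continuous_multiset_prod_map n).aestronglyMeasurable,
    lintegral_prod_map_dirichletMeasure hα, ENNReal.toReal_ofReal (dirichletMoment_nonneg hα n)]

end DirichletMeasure

section MixedMoment

variable {ι : Type*} [Fintype ι] {μ : Measure (ι → ℝ)}

theorem isExchangeableWeight_mixedMoment [IsProbabilityMeasure μ]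
    (hμ : ∀ᵐ y ∂μ, y ∈ stdSimplex ℝ ι) (hpos : ∀ᵐ y ∂μ, ∀ i, 0 < y i) :
    IsExchangeableWeight (mixedMoment μ) where
  pos n := by
    have hprod : ∀ᵐ y ∂μ, 0 < (n.map y).prod := by
      filter_upwards [hpos] with y hy
      exact Multiset.prod_pos (by simpa using fun i _ => hy i)
    have hnonneg := hprod.mono fun _ => le_of_lt
    refine (integral_nonneg_of_ae hnonneg).lt_of_ne' fun hzero => ?_
    rw [integral_eq_zero_iff_of_nonneg_ae hnonneg
      (integrable_multiset_prod_map (isCompact_stdSimplex ℝ ι) hμ n)] at hzero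
    obtain ⟨y, hy, hy₀⟩ := (hprod.and hzero).exists
    exact hy.ne' hy₀
  sum_cons n := by
    simp only [mixedMoment]
    rw [← integral_finsetSum _ fun i _ =>
      integrable_multiset_prod_map (isCompact_stdSimplex ℝ ι) hμ (i ::ₘ n)]
    refine integral_congr_ae ?_
    filter_upwards [hμ] with y hy
    simp only [Multiset.map_cons, Multiset.prod_cons, ← Finset.sum_mul, hy.2, one_mul]

theorem memLp_two_eval [IsFiniteMeasure μ] (hμ : ∀ᵐ y ∂μ, y ∈ stdSimplex ℝ ι) (i : ι) :
    MemLp (fun y => y i) 2 μ := by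
  rw [memLp_two_iff_integrable_sq (measurable_pi_apply i).aestronglyMeasurable]
  simpa [sq] using integrable_multiset_prod_map (isCompact_stdSimplex ℝ ι) hμ {i, i}

theorem variance_eval_eq_mixedMoment [IsProbabilityMeasure μ]
    (hμ : ∀ᵐ y ∂μ, y ∈ stdSimplex ℝ ι) (i : ι) :
    Var[fun y => y i; μ] = mixedMoment μ {i, i} - mixedMoment μ {i} ^ 2 := by
  rw [variance_eq_sub (memLp_two_eval hμ i)]
  simp [mixedMoment, sq]

theorem exists_predictive_mixedMoment_lt [IsProbabilityMeasure μ]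
    (hμ : ∀ᵐ y ∂μ, y ∈ stdSimplex ℝ ι) (hpos : ∀ᵐ y ∂μ, ∀ i, 0 < y i)
    (hconst : ¬ ∃ c, ∀ᵐ y ∂μ, y = c) :
    ∃ i, predictive (mixedMoment μ) 0 i < predictive (mixedMoment μ) {i} i := by
  have hM := isExchangeableWeight_mixedMoment hμ hpos
  by_contra! hle
  refine hconst ⟨fun i => ∫ y, y i ∂μ, ?_⟩
  have eval_const : ∀ i, ∀ᵐ y ∂μ, y i = ∫ y, y i ∂μ := by
    intro i
    refine ae_eq_integral_of_variance_eq_zero (memLp_two_eval hμ i)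
      (le_antisymm ?_ (variance_nonneg _ _))
    have h := hle i
    rw [predictive, predictive, Multiset.cons_zero, mixedMoment_zero, div_one,
      div_le_iff₀ (hM.pos {i}), ← sq] at h
    rw [variance_eval_eq_mixedMoment hμ]
    exact sub_nonpos.mpr h
  filter_upwards [ae_all_iff.mpr eval_const] with y hy
  exact funext hy

theorem isClassicalDirichlet_of_predictiveRatio_eq [Nontrivial ι] [DecidableEq ι]
    [IsProbabilityMeasure μ] (hμ : ∀ᵐ y ∂μ, y ∈ stdSimplex ℝ ι) (hpos : ∀ᵐ y ∂μ, ∀ i, 0 < y i)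
    (hconst : ¬ ∃ c, ∀ᵐ y ∂μ, y = c) {ρ : ℕ → ℝ}
    (hρ : ∀ i j n, i ≠ j → predictiveRatio (mixedMoment μ) i j n = ρ n.card) :
    IsClassicalDirichlet μ := by
  have hM := isExchangeableWeight_mixedMoment hμ hpos
  obtain ⟨α, hα, hpred⟩ := hM.exists_predictive_eq hρ
    (exists_predictive_mixedMoment_lt hμ hpos hconst)
  refine ⟨inferInstance, α, hα, fun i₀ => ?_⟩
  have := isProbabilityMeasure_dirichletMeasure hα i₀
  refine ext_of_mixedMoment_eq (isCompact_stdSimplex ℝ ι) hμ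
    (ae_mem_stdSimplex_dirichletMeasure α i₀) fun n => ?_
  rw [hM.eq_dirichletMoment mixedMoment_zero hα hpred, mixedMoment_dirichletMeasure hα]

end MixedMoment

section Cells

variable {V : Type*} {I : V → Type*} [Fintype V] [DecidableEq V]
  [∀ v, Fintype (I v)] [∀ v, DecidableEq (I v)] {q : (∀ v, I v) → ℝ}

theorem marginalProb_pos (hq : ∀ i, 0 < q i) (D : Finset V) (i : ∀ v, I v) :
    0 < marginalProb q D (D.restrict i) :=
  Finset.sum_pos (fun x _ => hq x) ⟨i, by simp⟩

theorem marginalProb_empty (q : (∀ v, I v) → ℝ) (k : ∀ u : (∅ : Finset V), I u) :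
    marginalProb q ∅ k = ∑ i, q i := by
  rw [marginalProb, Finset.filter_true_of_mem fun _ _ => Subsingleton.elim _ _]

theorem marginalProb_univ (q : (∀ v, I v) → ℝ) (i : ∀ v, I v) :
    marginalProb q Finset.univ (Finset.univ.restrict i) = q i := by
  have hfilter : ({x | Finset.univ.restrict x = Finset.univ.restrict i} : Finset (∀ v, I v)) =
      {i} := by
    ext x
    simp [funext_iff]
  rw [marginalProb, hfilter, Finset.sum_singleton]

theorem condCellProb_restrict_eq_div (q : (∀ v, I v) → ℝ) (v : V) (D : Finset V)
    (i : ∀ v, I v) : condCellProb q v D (D.restrict i) (i v) =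
      marginalProb q (insert v D) ((insert v D).restrict i) / marginalProb q D (D.restrict i) := by
  have hfilter : ∀ x : ∀ v, I v, D.restrict x = D.restrict i ∧ x v = i v ↔
      (insert v D).restrict x = (insert v D).restrict i := by
    intro x
    simp only [funext_iff, Finset.restrict, Subtype.forall, Finset.mem_insert, forall_eq_or_imp]
    exact and_comm
  simp only [condCellProb, marginalProb, hfilter]

theorem prod_condCellProb {d : ℕ} {𝔭 : V → Finset V} {v : Fin d ≃ V}
    (hv : IsVertexNumbering 𝔭 v) (hpos : ∀ i, 0 < q i) (hsum : ∑ i, q i = 1) (i : ∀ v, I v) :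
    ∏ u, condCellProb q u (𝔭 u) ((𝔭 u).restrict i) (i u) = q i := by
  rw [← marginalProb_univ q i]
  refine hv.univ_induction
    (C := fun D => ∏ u ∈ D, condCellProb q u (𝔭 u) ((𝔭 u).restrict i) (i u) =
      marginalProb q D (D.restrict i)) ?_ fun w ih => ?_
  · rw [Finset.prod_empty, marginalProb_empty, hsum]
  · rw [dagFamily, Finset.prod_insert (hv.notMem_parents_self w), ih, condCellProb_restrict_eq_div,
      div_mul_cancel₀ _ (marginalProb_pos hpos _ i).ne']

theorem prod_map_eq_prod_familySample {d : ℕ} {𝔭 : V → Finset V} {v : Fin d ≃ V}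
    (hv : IsVertexNumbering 𝔭 v) (hpos : ∀ i, 0 < q i) (hsum : ∑ i, q i = 1)
    (n : Multiset (∀ v, I v)) :
    (n.map q).prod =
      ∏ s, ((familySample 𝔭 s n).map (condCellProb q s.1 (𝔭 s.1) s.2)).prod := by
  induction n using Multiset.induction with
  | empty => simp [familySample]
  | cons i n ih =>
    have factor : ∀ s : (v : V) × (∀ u : 𝔭 v, I u),
        ((familySample 𝔭 s (i ::ₘ n)).map (condCellProb q s.1 (𝔭 s.1) s.2)).prod =
          (if (𝔭 s.1).restrict i = s.2 then condCellProb q s.1 (𝔭 s.1) s.2 (i s.1) else 1) *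
            ((familySample 𝔭 s n).map (condCellProb q s.1 (𝔭 s.1) s.2)).prod := by
      intro s
      split_ifs with hs
      · rw [familySample_cons_of_eq hs, Multiset.map_cons, Multiset.prod_cons]
      · rw [familySample_cons_of_ne hs, one_mul]
    rw [Multiset.map_cons, Multiset.prod_cons, ih, ← prod_condCellProb hv hpos hsum i]
    simp only [factor, Finset.prod_mul_distrib, Fintype.prod_sigma, Finset.prod_ite_eq,
      Finset.mem_univ, if_true]

end Cells

section RandomCellProb

variable {V : Type*} {I : V → Type*} [Fintype V] [DecidableEq V] [∀ v, Fintype (I v)]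
  {Ω : Type*} [MeasurableSpace Ω] {P : Measure Ω} {p : Ω → (∀ v, I v) → ℝ}

namespace IsRandomCellProb

theorem ae_mem_stdSimplex (hp : IsRandomCellProb P p) :
    ∀ᵐ y ∂P.map p, y ∈ stdSimplex ℝ (∀ v, I v) := by
  rw [ae_map_iff (p := (· ∈ stdSimplex ℝ (∀ v, I v))) hp.measurable.aemeasurable
    (isClosed_stdSimplex ℝ _).measurableSet]
  filter_upwards [hp.pos, hp.sum_eq_one] with ω hpos hsum
  exact ⟨fun i => (hpos i).le, hsum⟩

theorem ae_pos (hp : IsRandomCellProb P p) : ∀ᵐ y ∂P.map p, ∀ i, 0 < y i := by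
  simp only [ae_all_iff]
  intro i
  rw [ae_map_iff (p := fun y : (∀ v, I v) → ℝ => 0 < y i) hp.measurable.aemeasurable
    (measurableSet_lt measurable_const (measurable_pi_apply i))]
  filter_upwards [hp.pos] with ω hω using hω i

theorem nonempty_cells [IsProbabilityMeasure P] (hp : IsRandomCellProb P p) :
    Nonempty (∀ v, I v) := by
  obtain ⟨ω, hω⟩ := hp.sum_eq_one.exists
  by_contra hempty
  rw [not_nonempty_iff] at hempty
  simp at hω

end IsRandomCellProb

end RandomCellProb

section ParameterIndependence

variable {V : Type*} {I : V → Type*} [Fintype V] [DecidableEq V]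
  [∀ v, Fintype (I v)] [∀ v, DecidableEq (I v)]
  {Ω : Type*} [MeasurableSpace Ω] {P : Measure Ω} {p : Ω → (∀ v, I v) → ℝ} {𝔭 : V → Finset V}

theorem measurable_dagParameter (hp : Measurable p) (𝔭 : V → Finset V)
    (s : (v : V) × (∀ u : 𝔭 v, I u)) : Measurable (dagParameter p 𝔭 s) := by
  unfold dagParameter condCellProb marginalProb
  fun_prop

namespace IsRandomCellProb

theorem mixedMoment_eq_prod (hp : IsRandomCellProb P p) {d : ℕ} {v : Fin d ≃ V}
    (hv : IsVertexNumbering 𝔭 v) (hind : iIndepFun (dagParameter p 𝔭) P)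
    (n : Multiset (∀ v, I v)) :
    mixedMoment (P.map p) n =
      ∏ s, mixedMoment (P.map (dagParameter p 𝔭 s)) (familySample 𝔭 s n) := by
  have hmeas : ∀ s, AEMeasurable (dagParameter p 𝔭 s) P := fun s =>
    (measurable_dagParameter hp.measurable 𝔭 s).aemeasurable
  simp only [mixedMoment_map hp.measurable.aemeasurable, mixedMoment_map (hmeas _)]
  rw [← hind.integral_fun_prod_comp
    (f := fun s y => ((familySample 𝔭 s n).map y).prod) hmeas
    fun s => (continuous_multiset_prod_map _).aestronglyMeasurable]
  refine integral_congr_ae ?_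
  filter_upwards [hp.pos, hp.sum_eq_one] with ω hpos hsum
  exact prod_map_eq_prod_familySample hv hpos hsum n

theorem familyLocal_mixedMoment [IsProbabilityMeasure P] (hp : IsRandomCellProb P p) {d : ℕ}
    {v : Fin d ≃ V} (hv : IsVertexNumbering 𝔭 v) (hind : iIndepFun (dagParameter p 𝔭) P) :
    FamilyLocal 𝔭 (mixedMoment (P.map p)) := by
  have := Measure.isProbabilityMeasure_map (μ := P) hp.measurable.aemeasurable
  have hM := isExchangeableWeight_mixedMoment hp.ae_mem_stdSimplex hp.ae_pos
  have moment_eq := hp.mixedMoment_eq_prod hv hind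
  rw [funext moment_eq]
  refine hv.familyLocal_prod (g := fun s => mixedMoment (P.map (dagParameter p 𝔭 s)))
    fun s n => ?_
  exact Finset.prod_ne_zero_iff.mp (moment_eq n ▸ (hM.pos n).ne') s (Finset.mem_univ s)

end IsRandomCellProb

namespace ParameterIndependence

theorem nontrivial [IsProbabilityMeasure P] (hind : ParameterIndependence P p 𝔭)
    (hp : IsRandomCellProb P p) (v : V) : Nontrivial (I v) := by
  obtain ⟨i⟩ := hp.nonempty_cells
  by_contra htrivial
  rw [not_nontrivial_iff_subsingleton] at htrivial
  refine hind.nondegenerate ⟨v, (𝔭 v).restrict i⟩ ⟨fun _ => 1, ?_⟩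
  filter_upwards [hp.pos] with ω hpos
  ext m
  have hv : ∀ x : ∀ v, I v, x v = m := fun x => Subsingleton.elim _ _
  simp only [dagParameter, condCellProb, hv, and_true]
  exact div_self (marginalProb_pos hpos _ i).ne'

theorem not_ae_const [Nonempty V] [IsProbabilityMeasure P] (hind : ParameterIndependence P p 𝔭)
    (hp : IsRandomCellProb P p) : ¬ ∃ c, ∀ᵐ ω ∂P, p ω = c := by
  rintro ⟨c, hc⟩
  obtain ⟨i⟩ := hp.nonempty_cells
  obtain ⟨v⟩ := ‹Nonempty V›
  refine hind.nondegenerate ⟨v, (𝔭 v).restrict i⟩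
    ⟨condCellProb c v (𝔭 v) ((𝔭 v).restrict i), ?_⟩
  filter_upwards [hc] with ω hω
  ext m
  rw [dagParameter, hω]

end ParameterIndependence

end ParameterIndependence

theorem mainTheorem4_general {V : Type*} [Fintype V] [DecidableEq V]
    {I : V → Type*} [∀ v, Fintype (I v)] [∀ v, DecidableEq (I v)] [∀ v, Nontrivial (I v)]
    {d : ℕ} (hd : 2 ≤ d)
    {Ω : Type*} [MeasurableSpace Ω] (P : Measure Ω) [IsProbabilityMeasure P]
    (p : Ω → (∀ v, I v) → ℝ) (hp : IsRandomCellProb P p) (hconst : ¬ ∃ c, ∀ᵐ ω ∂P, p ω = c)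
    (𝔭 𝔭' : V → Finset V)
    (v v' : Fin d ≃ V) (hv : IsVertexNumbering 𝔭 v) (hv' : IsVertexNumbering 𝔭' v')
    (hne : ∀ j : Fin d, 1 ≤ j.val → 𝔭 (v j) ≠ 𝔭' (v' j))
    (hind : iIndepFun (dagParameter p 𝔭) P) (hind' : iIndepFun (dagParameter p 𝔭') P) :
    IsClassicalDirichlet (P.map p) := by
  have := Measure.isProbabilityMeasure_map (μ := P) hp.measurable.aemeasurable
  have : Nontrivial (∀ u, I u) := Pi.nontrivial_at (v ⟨0, by omega⟩)
  have hmap : ¬ ∃ c, ∀ᵐ y ∂P.map p, y = c := fun ⟨c, hc⟩ =>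
    hconst ⟨c, ae_of_ae_map hp.measurable.aemeasurable hc⟩
  obtain ⟨ρ, hρ⟩ := FamilyLocal.exists_predictiveRatio_eq hd hv hv' hne
    (hp.familyLocal_mixedMoment hv hind) (hp.familyLocal_mixedMoment hv' hind')
  exact isClassicalDirichlet_of_predictiveRatio_eq hp.ae_mem_stdSimplex hp.ae_pos hmap hρ

theorem mainTheorem4 {V : Type*} [Fintype V] [DecidableEq V]
    {I : V → Type*} [∀ v, Fintype (I v)] [∀ v, DecidableEq (I v)]
    {d : ℕ} (hd : 2 ≤ d)
    {Ω : Type*} [MeasurableSpace Ω] (P : Measure Ω) [IsProbabilityMeasure P]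
    (p : Ω → (∀ v, I v) → ℝ) (hp : IsRandomCellProb P p)
    (𝔭 𝔭' : V → Finset V)
    (h𝔭 : IsMoralDAG (⊤ : SimpleGraph V) 𝔭) (h𝔭' : IsMoralDAG (⊤ : SimpleGraph V) 𝔭')
    (v v' : Fin d ≃ V) (hv : IsVertexNumbering 𝔭 v) (hv' : IsVertexNumbering 𝔭' v')
    (hne : ∀ j : Fin d, 1 ≤ j.val → 𝔭 (v j) ≠ 𝔭' (v' j))
    (hind : ParameterIndependence P p 𝔭) (hind' : ParameterIndependence P p 𝔭') :
    IsClassicalDirichlet (P.map p) := by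
  have : Nonempty V := ⟨v ⟨0, by omega⟩⟩
  have := hind.nontrivial hp
  exact mainTheorem4_general hd P p hp (hind.not_ae_const hp) 𝔭 𝔭' v v' hv hv' hne
    hind.indep hind'.indep
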